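/- Let $r,\rho$ be real numbers with $0<r<1<\rho$ such that, for all integers $k,\ell$, $r^k=\rho^\ell$ if and only if $k=\ell=0$ (that is, $(r,\rho)\in\mathcal{NC}$). For $s>0$ let $L_s=\{(x,y)\in[0,1]^2 : y=sx\}$. In the Hilbert cube $Q=\prod_{i=1}^\infty[0,1]$ let $$M_{r,\rho}=\{(x_1,x_2,\ldots)\in Q : (x_i,x_{i+1})\in L_r\cup L_\rho\text{ for all }i\ge 1\},$$ and for a sequence $a=(a_1,a_2,\ldots)$ with all $a_i\in\{r,\rho\}$ let $$L_a=\{(x_1,x_2,\ldots)\in Q : (x_i,x_{i+1})\in L_{a_i}\text{ for all }i\ge 1\}.$$ Call $a$ useful if $L_a$ is an arc (homeomorphic to $[0,1]$), let $\mathcal U_{r,\rho}$ be the set of useful sequences, and for $a\in\mathcal U_{r,\rho}$ put $b^a_n=\max\{x_n : x\in L_a\}$, $n\ge1$. Recall: a continuum is a non-empty compact connected metrizable space; it is unicoherent if $A\cap B$ is connected whenever it is the union of two subcontinua $A,B$, and hereditarily unicoherent if each of its subcontinua is unicoherent. A dendroid is an arcwise connected (any two distinct points are the end-points of an arc in it),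 hereditarily unicoherent continuum. For a dendroid $X$, $E(X)$ is the set of points $x\in X$ that are an end-point of every arc in $X$ containing $x$, and $R(X)$ (the ramification points) is the set of images of $(0,0)$ under homeomorphisms from $([-1,1]\times\{0\})\cup(\{0\}\times[0,1])$ onto subspaces of $X$. A fan is a dendroid with at most one ramification point. **Theorem.** $M_{r,\rho}$ is a fan, $$E(M_{r,\rho})=\{(b^a_1,b^a_2,b^a_3,\ldots) : a\in\mathcal U_{r,\rho}\},\qquad R(M_{r,\rho})=\{(0,0,0,\ldots)\}.$$ -/

import Mathlib

namespace MahavierFan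

section Continua

/-! Notions of continuum theory, for a subset `S` of a topological space `X`
regarded as a subspace. -/

variable {X : Type*} [TopologicalSpace X]

/-- A continuum: a non-empty compact connected metrizable space. -/
def IsContinuum (S : Set X) : Prop :=
  TopologicalSpace.MetrizableSpace S ∧ IsCompact S ∧ IsConnected S

/-- Whenever the continuum is a union of two subcontinua, their intersection is connected. -/
def IsUnicoherent (S : Set X) : Prop :=
  ∀ A B : Set X, IsContinuum A → IsContinuum B → S = A ∪ B → IsConnected (A ∩ B)

/-- Every subcontinuum is unicoherent. -/
def IsHereditarilyUnicoherent (S : Set X) : Prop :=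
  ∀ K : Set X, K ⊆ S → IsContinuum K → IsUnicoherent K

/-- An arc: a space homeomorphic to `[0,1]`. -/
def IsArc (A : Set X) : Prop :=
  Nonempty (unitInterval ≃ₜ A)

/-- The point `x` is an end-point of the arc `A`. -/
def IsArcEndPoint (A : Set X) (x : X) : Prop :=
  ∃ φ : unitInterval ≃ₜ A, (φ 0 : X) = x

/-- Any two distinct points are the two end-points of an arc in `S`. -/
def IsArcwiseConnected (S : Set X) : Prop :=
  ∀ x ∈ S, ∀ y ∈ S, x ≠ y →
    ∃ A : Set X, A ⊆ S ∧ ∃ φ : unitInterval ≃ₜ A, (φ 0 : X) = x ∧ (φ 1 : X) = y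

/-- A dendroid: an arcwise connected, hereditarily unicoherent continuum. -/
def IsDendroid (S : Set X) : Prop :=
  IsContinuum S ∧ IsArcwiseConnected S ∧ IsHereditarilyUnicoherent S

/-- The end-points of `S`: points that are end-points of each arc in `S` containing them. -/
def endPoints (S : Set X) : Set X :=
  {x | x ∈ S ∧ ∀ A : Set X, A ⊆ S → IsArc A → x ∈ A → IsArcEndPoint A x}

/-- The model triod `([-1,1] × {0}) ∪ ({0} × [0,1])` in the plane. -/
def modelTriod : Set (ℝ × ℝ) :=
  (Set.Icc (-1) 1 ×ˢ {0}) ∪ ({0} ×ˢ Set.Icc 0 1)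

theorem origin_mem_modelTriod : ((0, 0) : ℝ × ℝ) ∈ modelTriod := by
  simp [modelTriod]

/-- `T` is a simple triod and `x` is a top of `T`. -/
def IsTriodWithTop (T : Set X) (x : X) : Prop :=
  ∃ φ : modelTriod ≃ₜ T, (φ ⟨(0, 0), origin_mem_modelTriod⟩ : X) = x

/-- The ramification points of `S`: the tops of simple triods in `S`. -/
def ramificationPoints (S : Set X) : Set X :=
  {x | ∃ T : Set X, T ⊆ S ∧ IsTriodWithTop T x}

/-- A fan: a dendroid with at most one ramification point. -/
def IsFan (S : Set X) : Prop :=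
  IsDendroid S ∧ (ramificationPoints S).Subsingleton

end Continua

/-- The Hilbert cube `[0,1]^ℕ` with the product topology (coordinates are indexed from `0`). -/
abbrev HilbertCube : Type := ℕ → unitInterval

/-- The infinite Mahavier product of a sequence of relations on a set:
the sequences `x` with `(x i, x (i + 1)) ∈ G i` for all `i`. -/
def mahavierProduct {X : Type*} (G : ℕ → Set (X × X)) : Set (ℕ → X) :=
  {x | ∀ i, (x i, x (i + 1)) ∈ G i}

/-- The segment `{(x, y) ∈ [0,1] × [0,1] | y = s x}`. -/
def lineRel (s : ℝ) : Set (unitInterval × unitInterval) :=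
  {p | (p.2 : ℝ) = s * (p.1 : ℝ)}

/-- `M_{r,ρ}`, the infinite Mahavier product of `L_r ∪ L_ρ`. -/
def fanM (r ρ : ℝ) : Set HilbertCube :=
  mahavierProduct fun _ => lineRel r ∪ lineRel ρ

/-- `L_a`, the Mahavier product of the segments `L_{a i}`. -/
def lineSeq (a : ℕ → ℝ) : Set HilbertCube :=
  mahavierProduct fun i => lineRel (a i)

/-- `r` and `ρ` never connect. -/
def NeverConnect (r ρ : ℝ) : Prop :=
  r < 1 ∧ 1 < ρ ∧ ∀ k l : ℤ, r ^ k = ρ ^ l ↔ k = 0 ∧ l = 0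

/-- The useful sequences: the sequences `a` in `{r, ρ}` for which `L_a` is an arc. -/
def usefulSeqs (r ρ : ℝ) : Set (ℕ → ℝ) :=
  {a | (∀ i, a i = r ∨ a i = ρ) ∧ IsArc (lineSeq a)}

/-- `b^a_n`, the maximum of the `n`-th projection of `L_a`; it is attained by
`isGreatest_maxCoord`. -/
noncomputable def maxCoord (a : ℕ → ℝ) : HilbertCube :=
  fun n => sSup ((fun x : HilbertCube => x n) '' lineSeq a)

theorem isGreatest_maxCoord (a : ℕ → ℝ) (n : ℕ) :
    IsGreatest ((fun x : HilbertCube => x n) '' lineSeq a) (maxCoord a n) := by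
  have hc : IsClosed (lineSeq a) := by
    have h : lineSeq a =
        ⋂ i, {x : HilbertCube | ((x (i + 1) : unitInterval) : ℝ) = a i * (x i : ℝ)} := by
      ext x
      simp [lineSeq, mahavierProduct, lineRel]
    rw [h]
    exact isClosed_iInter fun i => isClosed_eq (by fun_prop) (by fun_prop)
  have h0 : (fun _ => 0 : HilbertCube) ∈ lineSeq a := by
    simp [lineSeq, mahavierProduct, lineRel]
  exact (hc.isCompact.image (continuous_apply n)).isGreatest_sSup ⟨_, _, h0, rfl⟩

end MahavierFan

open MahavierFan

namespace MahavierFan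

open Set Topology

/-! `fanM r ρ` is a cone over the origin. It is the union of the sets `lineSeq a`. Each is closed
under scaling by `[0,1]` and is determined by coordinate `0`, so it is either `{0}` or the segment
of all `t • maxCoord a`. A nonzero point has no zero coordinate, hence its successive ratios
determine `a`, and different rays meet only at the origin.

The topology is subtle because infinitely many rays may accumulate on one ray. Two facts control
this. Away from the origin each ratio is locally constant, so a connected set missing `0` lies on
one ray (`subset_lineSeq_of_isPreconnected`). A closed connected set meets each ray in a convex set
(`smul_mem_of_isPreconnected`). The latter gives hereditary unicoherence. By the former, an arc or
triod near a nonzero point is confined to a segment, so the tips of the nondegenerate rays are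
end-points and no nonzero point is a ramification point. Three explicit rays show that the origin is
one. -/

theorem mem_lineSeq {a : ℕ → ℝ} {x : HilbertCube} :
    x ∈ lineSeq a ↔ ∀ i, (x (i + 1) : ℝ) = a i * x i := Iff.rfl

theorem mem_fanM {r ρ : ℝ} {x : HilbertCube} :
    x ∈ fanM r ρ ↔ ∀ i, (x (i + 1) : ℝ) = r * x i ∨ (x (i + 1) : ℝ) = ρ * x i := Iff.rfl

/-! ### Scaling and rays. -/

theorem coe_smul_apply (t : unitInterval) (x : HilbertCube) (n : ℕ) :
    (((t • x) n : unitInterval) : ℝ) = t * x n := rfl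

theorem smul_left_cancel_of_ne_zero {x : HilbertCube} (hx : x ≠ 0) {s t : unitInterval}
    (h : s • x = t • x) : s = t := by
  obtain ⟨n, hn⟩ := Function.ne_iff.1 hx
  have h1 : (s : ℝ) * x n = t * x n := congrArg Subtype.val (congrFun h n)
  have h2 : (x n : ℝ) ≠ 0 := fun h => hn (Subtype.ext h)
  exact Subtype.ext (mul_right_cancel₀ h2 h1)

theorem zero_smul_cube (x : HilbertCube) : (0 : unitInterval) • x = 0 := by
  funext n; exact zero_mul _

theorem eq_zero_of_smul_eq_zero {x : HilbertCube} (hx : x ≠ 0) {s : unitInterval}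
    (h : s • x = 0) : s = 0 :=
  smul_left_cancel_of_ne_zero hx (h.trans (zero_smul_cube x).symm)

theorem smul_mem_lineSeq {a : ℕ → ℝ} {x : HilbertCube} (hx : x ∈ lineSeq a)
    (t : unitInterval) : t • x ∈ lineSeq a := fun i => by
  show (t : ℝ) * x (i + 1) = a i * (t * x i)
  rw [mem_lineSeq.1 hx i]; ring

theorem smul_mem_fanM {r ρ : ℝ} {x : HilbertCube} (hx : x ∈ fanM r ρ)
    (t : unitInterval) : t • x ∈ fanM r ρ := by
  refine mem_fanM.2 fun i => ?_
  simp only [coe_smul_apply]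
  rcases mem_fanM.1 hx i with h | h
  · left; rw [h]; ring
  · right; rw [h]; ring

theorem eq_of_mem_lineSeq {a : ℕ → ℝ} {x y : HilbertCube} (hx : x ∈ lineSeq a)
    (hy : y ∈ lineSeq a) (h : x 0 = y 0) : x = y := by
  funext n
  induction n with
  | zero => exact h
  | succ n ih => exact Subtype.ext (by rw [mem_lineSeq.1 hx, mem_lineSeq.1 hy, ih])

theorem exists_eq_smul_of_le {a : ℕ → ℝ} {x y : HilbertCube} (hx : x ∈ lineSeq a)
    (hy : y ∈ lineSeq a) (h : x 0 ≤ y 0) : ∃ t : unitInterval, x = t • y := by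
  have h' : (x 0 : ℝ) ≤ y 0 := h
  -- If `y 0 = 0`, the quotient is `0` by convention, and `x 0 = 0` as well.
  refine ⟨⟨x 0 / y 0, div_nonneg (x 0).2.1 (y 0).2.1, div_le_one_of_le₀ h' (y 0).2.1⟩,
    eq_of_mem_lineSeq hx (smul_mem_lineSeq hy _) (Subtype.ext ?_)⟩
  show (x 0 : ℝ) = x 0 / y 0 * y 0
  by_cases hy0 : (y 0 : ℝ) = 0
  · have hx0 : (x 0 : ℝ) = 0 := le_antisymm (h'.trans hy0.le) (x 0).2.1
    rw [hx0, hy0, mul_zero]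
  · exact (div_mul_cancel₀ _ hy0).symm

theorem lineSeq_subset_fanM {r ρ : ℝ} {a : ℕ → ℝ} (ha : ∀ i, a i = r ∨ a i = ρ) :
    lineSeq a ⊆ fanM r ρ := fun x hx => mem_fanM.2 fun i => by
  rcases ha i with h | h
  · left; rw [← h]; exact hx i
  · right; rw [← h]; exact hx i

theorem exists_mem_lineSeq {r ρ : ℝ} {x : HilbertCube} (hx : x ∈ fanM r ρ) :
    ∃ a : ℕ → ℝ, (∀ i, a i = r ∨ a i = ρ) ∧ x ∈ lineSeq a := by
  have h : ∀ i, ∃ c : ℝ, (c = r ∨ c = ρ) ∧ (x (i + 1) : ℝ) = c * x i := fun i => by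
    rcases mem_fanM.1 hx i with h | h
    · exact ⟨r, .inl rfl, h⟩
    · exact ⟨ρ, .inr rfl, h⟩
  choose a h1 h2 using h
  exact ⟨a, h1, h2⟩

theorem zero_mem_lineSeq (a : ℕ → ℝ) : (0 : HilbertCube) ∈ lineSeq a := fun i => by
  show (0 : ℝ) = a i * 0
  simp

theorem zero_mem_fanM (r ρ : ℝ) : (0 : HilbertCube) ∈ fanM r ρ := fun _ => by
  left
  show (0 : ℝ) = r * 0
  simp

/-- Nonzero slopes carry a zero back to coordinate `0`, which determines the whole point. -/
theorem eq_zero_of_apply_eq_zero {r ρ : ℝ} (hr : 0 < r) (hρ : 0 < ρ) {x : HilbertCube}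
    (hx : x ∈ fanM r ρ) {n : ℕ} (hn : x n = 0) : x = 0 := by
  have h0 : x 0 = 0 := by
    induction n with
    | zero => exact hn
    | succ n ih =>
      apply ih
      have h1 : (x (n + 1) : ℝ) = 0 := congrArg Subtype.val hn
      apply Subtype.ext
      show (x n : ℝ) = 0
      rcases mem_fanM.1 hx n with h | h <;> rw [h1] at h
      · exact (mul_eq_zero.1 h.symm).resolve_left hr.ne'
      · exact (mul_eq_zero.1 h.symm).resolve_left hρ.ne'
  obtain ⟨a, -, hxa⟩ := exists_mem_lineSeq hx
  exact eq_of_mem_lineSeq hxa (zero_mem_lineSeq a) h0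

theorem apply_ne_zero {r ρ : ℝ} (hr : 0 < r) (hρ : 0 < ρ) {x : HilbertCube}
    (hx : x ∈ fanM r ρ) (hx0 : x ≠ 0) (n : ℕ) : (x n : ℝ) ≠ 0 :=
  fun h => hx0 (eq_zero_of_apply_eq_zero hr hρ hx (n := n) (Subtype.ext h))

theorem seq_unique {r ρ : ℝ} (hr : 0 < r) (hρ : 0 < ρ) {a b : ℕ → ℝ}
    (ha : ∀ i, a i = r ∨ a i = ρ) {x : HilbertCube} (hxa : x ∈ lineSeq a)
    (hxb : x ∈ lineSeq b) (hx0 : x ≠ 0) : a = b := by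
  funext i
  exact mul_right_cancel₀ (apply_ne_zero hr hρ (lineSeq_subset_fanM ha hxa) hx0 i)
    ((hxa i).symm.trans (hxb i))

/-! ### Connected subsets and hereditary unicoherence. -/

theorem isClosed_setOf_ratio (i : ℕ) (c : ℝ) :
    IsClosed {x : HilbertCube | (x (i + 1) : ℝ) = c * x i} :=
  isClosed_eq (by fun_prop) (by fun_prop)

theorem isClosed_fanM (r ρ : ℝ) : IsClosed (fanM r ρ) := by
  have h : fanM r ρ = ⋂ i, ({x : HilbertCube | (x (i + 1) : ℝ) = r * x i} ∪
      {x : HilbertCube | (x (i + 1) : ℝ) = ρ * x i}) := by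
    ext x
    simp [mem_fanM]
  rw [h]
  exact isClosed_iInter fun i => (isClosed_setOf_ratio i r).union (isClosed_setOf_ratio i ρ)

/-- A connected set in `M_{r,ρ}` that misses the origin lies on a single ray. -/
theorem subset_lineSeq_of_isPreconnected {r ρ : ℝ} (hr : 0 < r) (hρ : 0 < ρ) (hrρ : r ≠ ρ)
    {S : Set HilbertCube} (hS : S ⊆ fanM r ρ) (hc : IsPreconnected S) (h0 : 0 ∉ S)
    {a : ℕ → ℝ} (ha : ∀ i, a i = r ∨ a i = ρ) {x : HilbertCube} (hx : x ∈ S)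
    (hxa : x ∈ lineSeq a) : S ⊆ lineSeq a := by
  intro y hy i
  show (y (i + 1) : ℝ) = a i * y i
  by_contra hne
  -- `r + ρ - a i` is the slope in `{r, ρ}` other than `a i`. The two closed sets cover `S` and meet
  -- `fanM r ρ` only at the origin.
  obtain ⟨w, hw, hw1, hw2⟩ := isPreconnected_closed_iff.1 hc _ _
    (isClosed_setOf_ratio i (a i)) (isClosed_setOf_ratio i (r + ρ - a i))
    (fun z hz => by
      rcases ha i with h | h <;> rcases mem_fanM.1 (hS hz) i with h' | h' <;>
        simp [h, h'])
    ⟨x, hx, hxa i⟩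
    ⟨y, hy, by
      rcases ha i with h | h <;> rcases mem_fanM.1 (hS hy) i with h' | h' <;>
        simp_all⟩
  have hwi := apply_ne_zero hr hρ (hS hw) (fun h => h0 (h ▸ hw)) i
  have h := mul_right_cancel₀ hwi (hw1.symm.trans hw2)
  rcases ha i with h' | h' <;> exact hrρ (by linarith)

/-- A closed connected subset of `M_{r,ρ}` meets each ray in a convex set. -/
theorem smul_mem_of_isPreconnected {r ρ : ℝ} (hr : 0 < r) (hρ : 0 < ρ) (hrρ : r ≠ ρ)
    {A : Set HilbertCube} (hA : A ⊆ fanM r ρ) (hcl : IsClosed A) (hc : IsPreconnected A)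
    {x : HilbertCube} (hx : x ∈ A) {s t : unitInterval} (hs : s • x ∈ A) (hst : s ≤ t) :
    t • x ∈ A := by
  rcases eq_or_ne x 0 with rfl | hx0
  · have : t • (0 : HilbertCube) = 0 := by funext n; exact mul_zero _
    rwa [this]
  rcases eq_or_ne t 0 with rfl | ht0
  · rwa [le_antisymm hst s.2.1] at hs
  obtain ⟨a, ha, hxa⟩ := exists_mem_lineSeq (hA hx)
  have hx0' : 0 < (x 0 : ℝ) := (x 0).2.1.lt_of_ne' (apply_ne_zero hr hρ (hA hx) hx0 0)
  have ht0' : 0 < (t : ℝ) := t.2.1.lt_of_ne' fun h => ht0 (Subtype.ext h)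
  -- It suffices to approximate `t • x` by points of `A`. `C` fixes the first `n` slopes to those of
  -- `a`, and `D` says that one of them differs. Splitting `C` at height `t * x 0` and adding `D` to
  -- the lower half gives two closed sets covering `A`, which must meet in `A`.
  have key : ∀ n : ℕ, ∃ y ∈ A, ∀ i ≤ n, y i = (t • x) i := by
    intro n
    let C : Set HilbertCube := ⋂ i ∈ Finset.range n, {y | (y (i + 1) : ℝ) = a i * y i}
    let D : Set HilbertCube :=
      ⋃ i ∈ Finset.range n, {y | (y (i + 1) : ℝ) = (r + ρ - a i) * y i}
    have hC : IsClosed C := isClosed_biInter fun i _ => isClosed_setOf_ratio i _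
    have hD : IsClosed D := isClosed_biUnion_finset fun i _ => isClosed_setOf_ratio i _
    have h1 : IsClosed {y : HilbertCube | (t : ℝ) * x 0 ≤ y 0} :=
      isClosed_le (by fun_prop) (by fun_prop)
    have h2 : IsClosed {y : HilbertCube | (y 0 : ℝ) ≤ t * x 0} :=
      isClosed_le (by fun_prop) (by fun_prop)
    have hline : ∀ z ∈ lineSeq a, z ∈ C := fun z hz => mem_iInter₂.2 fun i _ => hz i
    obtain ⟨y, hy, ⟨hyC, hy1⟩, hy2⟩ := isPreconnected_closed_iff.1 hc _ _
      (hC.inter h1) ((hC.inter h2).union hD)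
      (fun z hz => by
        by_cases hzC : z ∈ C
        · rcases le_total ((t : ℝ) * x 0) (z 0) with h | h
          · exact .inl ⟨hzC, h⟩
          · exact .inr (.inl ⟨hzC, h⟩)
        · right; right
          simp only [C, mem_iInter, not_forall] at hzC
          obtain ⟨i, hi, hne⟩ := hzC
          refine mem_iUnion₂.2 ⟨i, hi, ?_⟩
          rcases ha i with h | h <;> rcases mem_fanM.1 (hA hz) i with h' | h' <;>
            simp_all)
      ⟨x, hx, hline x hxa, mul_le_of_le_one_left (x 0).2.1 t.2.2⟩
      ⟨s • x, hs, .inl ⟨hline _ (smul_mem_lineSeq hxa s),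
        mul_le_mul_of_nonneg_right (show (s : ℝ) ≤ t from hst) (x 0).2.1⟩⟩
    have hyC' : ∀ i < n, (y (i + 1) : ℝ) = a i * y i := fun i hi =>
      mem_iInter₂.1 hyC i (Finset.mem_range.2 hi)
    have hy1' : (t : ℝ) * x 0 ≤ y 0 := hy1
    refine ⟨y, hy, ?_⟩
    rcases hy2 with ⟨-, hy2⟩ | hyD
    · have hy2' : (y 0 : ℝ) ≤ t * x 0 := hy2
      intro i
      induction i with
      | zero => exact fun _ => Subtype.ext (le_antisymm hy2' hy1')
      | succ i ih =>
        intro hi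
        apply Subtype.ext
        rw [hyC' i hi, ih (by omega), smul_mem_lineSeq hxa t i]
    -- A point of both `C` and `D` would be the origin, which lies below the positive height `t * x
    -- 0`.
    · obtain ⟨i, hi, hyi⟩ := mem_iUnion₂.1 hyD
      have hyi' : (y (i + 1) : ℝ) = (r + ρ - a i) * y i := hyi
      rw [hyC' i (Finset.mem_range.1 hi)] at hyi'
      have hy0 : y ≠ 0 := by
        rintro rfl
        have : (t : ℝ) * x 0 ≤ 0 := hy1'
        exact absurd (mul_pos ht0' hx0') (not_lt.2 this)
      have h := mul_right_cancel₀ (apply_ne_zero hr hρ (hA hy) hy0 i) hyi'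
      rcases ha i with h' | h' <;> exact absurd (by linarith) hrρ
  choose y hyA hy using key
  refine hcl.mem_of_tendsto (f := y) (b := Filter.atTop) (tendsto_pi_nhds.2 fun i => ?_)
    (.of_forall hyA)
  exact tendsto_const_nhds.congr' <| (Filter.eventually_ge_atTop i).mono
    fun n hn => (hy n i hn).symm

theorem continuous_smul_cube (x : HilbertCube) :
    Continuous fun t : unitInterval => t • x := by
  exact continuous_pi fun n => continuous_mul_const (x n)

theorem isPreconnected_segment (s : unitInterval) (x : HilbertCube) :
    IsPreconnected ((fun t : unitInterval => t • x) '' Icc s 1) :=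
  isPreconnected_Icc.image _ (continuous_smul_cube x).continuousOn

theorem isPreconnected_of_starShaped {S : Set HilbertCube}
    (h : ∀ x ∈ S, ∀ t : unitInterval, t • x ∈ S) : IsPreconnected S := by
  refine isPreconnected_of_forall 0 fun x hx => ⟨_, ?_, ?_, ?_, isPreconnected_segment 0 x⟩
  · rintro _ ⟨t, -, rfl⟩
    exact h x hx t
  · exact ⟨0, ⟨le_rfl, zero_le_one⟩, zero_smul_cube x⟩
  · exact ⟨1, ⟨zero_le_one, le_rfl⟩, one_smul _ x⟩

theorem isContinuum_fanM (r ρ : ℝ) : IsContinuum (fanM r ρ) :=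
  ⟨inferInstance, (isClosed_fanM r ρ).isCompact, ⟨0, zero_mem_fanM r ρ⟩,
    isPreconnected_of_starShaped fun _ hx t => smul_mem_fanM hx t⟩

/-- Since `A` misses the origin it lies on one ray. Two points of `A ∩ B` are then multiples of one
another, and convexity along the ray puts the segment between them in both sets. -/
theorem isPreconnected_inter_of_zero_notMem {r ρ : ℝ} (hr : 0 < r) (hρ : 0 < ρ) (hrρ : r ≠ ρ)
    {A B : Set HilbertCube} (hA : A ⊆ fanM r ρ) (hB : B ⊆ fanM r ρ) (hAc : IsClosed A)
    (hBc : IsClosed B) (hA' : IsPreconnected A) (hB' : IsPreconnected B) (h0 : 0 ∉ A) :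
    IsPreconnected (A ∩ B) := by
  have aux : ∀ x ∈ A ∩ B, ∀ t : unitInterval, t • x ∈ A ∩ B →
      ∃ S ⊆ A ∩ B, x ∈ S ∧ t • x ∈ S ∧ IsPreconnected S := by
    refine fun x hx t ht => ⟨(fun t : unitInterval => t • x) '' Icc t 1, ?_,
      ⟨1, ⟨t.2.2, le_rfl⟩, one_smul _ x⟩,
      ⟨t, ⟨le_rfl, t.2.2⟩, rfl⟩, isPreconnected_segment t x⟩
    rintro _ ⟨u, hu, rfl⟩
    exact ⟨smul_mem_of_isPreconnected hr hρ hrρ hA hAc hA' hx.1 ht.1 hu.1,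
      smul_mem_of_isPreconnected hr hρ hrρ hB hBc hB' hx.2 ht.2 hu.1⟩
  refine isPreconnected_of_forall_pair fun x hx y hy => ?_
  obtain ⟨a, ha, hxa⟩ := exists_mem_lineSeq (hA hx.1)
  have hya := subset_lineSeq_of_isPreconnected hr hρ hrρ hA hA' h0 ha hx.1 hxa hy.1
  rcases le_total (x 0) (y 0) with h | h
  · obtain ⟨t, rfl⟩ := exists_eq_smul_of_le hxa hya h
    obtain ⟨S, h1, h2, h3, h4⟩ := aux y hy t hx
    exact ⟨S, h1, h3, h2, h4⟩
  · obtain ⟨t, rfl⟩ := exists_eq_smul_of_le hya hxa h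
    exact aux x hx t hy

theorem isHereditarilyUnicoherent_fanM {r ρ : ℝ} (hr : 0 < r) (hρ : 0 < ρ) (hrρ : r ≠ ρ) :
    IsHereditarilyUnicoherent (fanM r ρ) := by
  rintro K hK ⟨-, -, hKc⟩ A B ⟨-, hAk, hAc⟩ ⟨-, hBk, hBc⟩ rfl
  have hA : A ⊆ fanM r ρ := subset_union_left.trans hK
  have hB : B ⊆ fanM r ρ := subset_union_right.trans hK
  refine ⟨?_, ?_⟩
  · obtain ⟨a, ha⟩ := hAc.nonempty
    obtain ⟨b, hb⟩ := hBc.nonempty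
    exact (isPreconnected_closed_iff.1 hKc.isPreconnected A B hAk.isClosed hBk.isClosed
      subset_rfl ⟨a, .inl ha, ha⟩ ⟨b, .inr hb, hb⟩).mono inter_subset_right
  · by_cases h0A : (0 : HilbertCube) ∈ A
    · by_cases h0B : (0 : HilbertCube) ∈ B
      -- With the origin in both sets, convexity along rays makes the intersection star-shaped about
      -- it.
      · refine isPreconnected_of_starShaped fun x hx t => ⟨?_, ?_⟩
        · exact smul_mem_of_isPreconnected hr hρ hrρ hA hAk.isClosed hAc.isPreconnected hx.1
            (s := 0) (by rwa [zero_smul_cube]) t.2.1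
        · exact smul_mem_of_isPreconnected hr hρ hrρ hB hBk.isClosed hBc.isPreconnected hx.2
            (s := 0) (by rwa [zero_smul_cube]) t.2.1
      · rw [inter_comm]
        exact isPreconnected_inter_of_zero_notMem hr hρ hrρ hB hA hBk.isClosed hAk.isClosed
          hBc.isPreconnected hAc.isPreconnected h0B
    · exact isPreconnected_inter_of_zero_notMem hr hρ hrρ hA hB hAk.isClosed hBk.isClosed
        hAc.isPreconnected hBc.isPreconnected h0A

/-! ### Arcs and their end-points. -/

theorem exists_homeomorph_range {K X : Type*} [TopologicalSpace K] [TopologicalSpace X]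
    [CompactSpace K] [T2Space X] {f : K → X} (hf : Continuous f) (hi : Function.Injective f) :
    ∃ φ : K ≃ₜ range f, ∀ k, (φ k : X) = f k :=
  ⟨(hf.isClosedEmbedding hi).isEmbedding.toHomeomorph, fun _ => rfl⟩

/-- End-points do not depend on the parametrization: a continuous injection of `[0,1]` into itself
is strictly monotone, so it cannot take the value `0` at an interior point. -/
theorem IsArcEndPoint.eq_zero_or_one {X : Type*} [TopologicalSpace X] {A : Set X} {x : X}
    (h : IsArcEndPoint A x) (φ : unitInterval ≃ₜ A) {t : unitInterval} (ht : (φ t : X) = x) :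
    t = 0 ∨ t = 1 := by
  obtain ⟨ψ, hψ⟩ := h
  have h0 : ψ.symm (φ t) = 0 := by
    rw [Homeomorph.symm_apply_eq]; exact Subtype.ext (ht.trans hψ.symm)
  have hinj : Function.Injective fun s => ψ.symm (φ s) := ψ.symm.injective.comp φ.injective
  have hcont : Continuous fun s => ψ.symm (φ s) := by fun_prop
  by_contra! hne
  rcases hcont.strictMono_of_inj hinj with hm | hm
  · have h1 := hm (unitInterval.pos_iff_ne_zero.2 hne.1)
    simp only [h0] at h1
    exact absurd h1 (not_lt.2 unitInterval.nonneg')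
  · have h1 := hm (unitInterval.lt_one_iff_ne_one.2 hne.2)
    simp only [h0] at h1
    exact absurd h1 (not_lt.2 unitInterval.nonneg')

theorem isArcEndPoint_of_eq_zero_or_one {X : Type*} [TopologicalSpace X] {A : Set X} {x : X}
    (φ : unitInterval ≃ₜ A) {t : unitInterval} (ht : (φ t : X) = x) (h : t = 0 ∨ t = 1) :
    IsArcEndPoint A x := by
  rcases h with rfl | rfl
  · exact ⟨φ, ht⟩
  · exact ⟨unitInterval.symmHomeomorph.trans φ, by simpa using ht⟩

/-- The retraction of the line onto the unit interval. -/
noncomputable def clamp (u : ℝ) : unitInterval := projIcc 0 1 zero_le_one u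

theorem continuous_clamp : Continuous clamp :=
  continuous_projIcc (h := zero_le_one)

theorem clamp_of_nonpos {u : ℝ} (hu : u ≤ 0) : clamp u = 0 := projIcc_of_le_left _ hu

theorem coe_clamp {u : ℝ} (hu : u ∈ Icc (0 : ℝ) 1) : (clamp u : ℝ) = u :=
  congrArg Subtype.val (projIcc_of_mem _ hu)

theorem clamp_coe (t : unitInterval) : clamp t = t := projIcc_val _ t

theorem clamp_one : clamp 1 = 1 := projIcc_right _

/-! ### Pairs of rays and arcwise connectedness. -/

/-- Points `x` and `y` lie on rays that meet in the origin only. -/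
def OnDifferentRays (x y : HilbertCube) : Prop :=
  x ≠ 0 ∧ y ≠ 0 ∧ ∀ s t : unitInterval, s • x = t • y → s • x = 0

theorem OnDifferentRays.eq_zero {x y : HilbertCube} (h : OnDifferentRays x y)
    {s t : unitInterval} (hst : s • x = t • y) : s = 0 ∧ t = 0 := by
  have h0 := h.2.2 s t hst
  exact ⟨eq_zero_of_smul_eq_zero h.1 h0, eq_zero_of_smul_eq_zero h.2.1 (hst ▸ h0)⟩

theorem onDifferentRays_of_seq_ne {r ρ : ℝ} (hr : 0 < r) (hρ : 0 < ρ) {a b : ℕ → ℝ}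
    (ha : ∀ i, a i = r ∨ a i = ρ) {x y : HilbertCube} (hx : x ∈ lineSeq a) (hy : y ∈ lineSeq b)
    (hx0 : x ≠ 0) (hy0 : y ≠ 0) (hab : a ≠ b) : OnDifferentRays x y := by
  refine ⟨hx0, hy0, fun s t h => ?_⟩
  by_contra hne
  exact hab (seq_unique hr hρ ha (smul_mem_lineSeq hx s) (h ▸ smul_mem_lineSeq hy t) hne)

/-- A parametrization by `[-1, 1]` of the union of the segments from the origin to `x`, `y`. -/
noncomputable def doubleRay (x y : HilbertCube) (u : ℝ) : HilbertCube :=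
  fun n => clamp u * x n ⊔ clamp (-u) * y n

/-- The maximum in `doubleRay` avoids gluing at the origin: one of the two clamped factors always
vanishes, and continuity is immediate. -/
theorem continuous_doubleRay (x y : HilbertCube) : Continuous (doubleRay x y) := by
  have := continuous_clamp
  unfold doubleRay
  fun_prop

theorem doubleRay_of_nonneg (x y : HilbertCube) {u : ℝ} (hu : 0 ≤ u) :
    doubleRay x y u = clamp u • x := by
  funext n
  have h : clamp (-u) = 0 := clamp_of_nonpos (by linarith)
  simp only [doubleRay, h, zero_mul]
  exact sup_eq_left.2 unitInterval.nonneg'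

theorem doubleRay_of_nonpos (x y : HilbertCube) {u : ℝ} (hu : u ≤ 0) :
    doubleRay x y u = clamp (-u) • y := by
  funext n
  simp only [doubleRay, clamp_of_nonpos hu, zero_mul]
  exact sup_eq_right.2 unitInterval.nonneg'

theorem doubleRay_zero (x y : HilbertCube) : doubleRay x y 0 = 0 := by
  rw [doubleRay_of_nonneg x y le_rfl, clamp_of_nonpos le_rfl, zero_smul_cube]

theorem doubleRay_one (x y : HilbertCube) : doubleRay x y 1 = x := by
  rw [doubleRay_of_nonneg x y zero_le_one, clamp_one, one_smul]

theorem doubleRay_neg_one (x y : HilbertCube) : doubleRay x y (-1) = y := by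
  rw [doubleRay_of_nonpos x y (by norm_num), neg_neg, clamp_one, one_smul]

theorem OnDifferentRays.injOn_doubleRay {x y : HilbertCube} (h : OnDifferentRays x y) :
    InjOn (doubleRay x y) (Icc (-1) 1) := by
  have aux : ∀ u ∈ Icc (0 : ℝ) 1, ∀ v ∈ Icc (-1 : ℝ) 0,
      doubleRay x y u = doubleRay x y v → u = v := fun u hu v hv huv => by
    rw [doubleRay_of_nonneg x y hu.1, doubleRay_of_nonpos x y hv.2] at huv
    obtain ⟨h1, h2⟩ := h.eq_zero huv
    have h1' := coe_clamp hu
    have h2' := coe_clamp (u := -v) ⟨by linarith [hv.2], by linarith [hv.1]⟩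
    rw [h1] at h1'
    rw [h2] at h2'
    have h3 : (0 : ℝ) = u := h1'
    have h4 : (0 : ℝ) = -v := h2'
    linarith
  intro u hu v hv huv
  rcases le_total 0 u with hu0 | hu0 <;> rcases le_total 0 v with hv0 | hv0
  · rw [doubleRay_of_nonneg x y hu0, doubleRay_of_nonneg x y hv0] at huv
    rw [← coe_clamp ⟨hu0, hu.2⟩, ← coe_clamp ⟨hv0, hv.2⟩,
      smul_left_cancel_of_ne_zero h.1 huv]
  · exact aux u ⟨hu0, hu.2⟩ v ⟨hv.1, hv0⟩ huv
  · exact (aux v ⟨hv0, hv.2⟩ u ⟨hu.1, hu0⟩ huv.symm).symm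
  · rw [doubleRay_of_nonpos x y hu0, doubleRay_of_nonpos x y hv0] at huv
    have := smul_left_cancel_of_ne_zero h.2.1 huv
    rw [← neg_inj, ← coe_clamp (u := -u) ⟨by linarith, by linarith [hu.1]⟩,
      ← coe_clamp (u := -v) ⟨by linarith, by linarith [hv.1]⟩, this]

theorem doubleRay_mem_fanM {r ρ : ℝ} {x y : HilbertCube} (hx : x ∈ fanM r ρ)
    (hy : y ∈ fanM r ρ) (u : ℝ) : doubleRay x y u ∈ fanM r ρ := by
  rcases le_total 0 u with h | h
  · rw [doubleRay_of_nonneg x y h]; exact smul_mem_fanM hx _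
  · rw [doubleRay_of_nonpos x y h]; exact smul_mem_fanM hy _

theorem OnDifferentRays.exists_arc {r ρ : ℝ} {x y : HilbertCube} (h : OnDifferentRays x y)
    (hx : x ∈ fanM r ρ) (hy : y ∈ fanM r ρ) :
    ∃ A ⊆ fanM r ρ, ∃ φ : unitInterval ≃ₜ A,
      ∀ t, (φ t : HilbertCube) = doubleRay x y (1 - 2 * t) := by
  -- The parameter `1 - 2 * t` runs from `1` (the point `x`) through `0` (the origin, at `t = 1/2`)
  -- to `-1` (the point `y`).
  obtain ⟨φ, hφ⟩ := exists_homeomorph_range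
    (f := fun t : unitInterval => doubleRay x y (1 - 2 * t))
    ((continuous_doubleRay x y).comp (by fun_prop)) (fun s t hst => by
      have := h.injOn_doubleRay ⟨by linarith [s.2.2], by linarith [s.2.1]⟩
        ⟨by linarith [t.2.2], by linarith [t.2.1]⟩ hst
      exact Subtype.ext (by linarith))
  refine ⟨_, ?_, φ, hφ⟩
  rintro _ ⟨t, rfl⟩
  exact doubleRay_mem_fanM hx hy _

theorem exists_arc_smul {r ρ : ℝ} {y : HilbertCube} (hy : y ∈ fanM r ρ) (s : unitInterval)
    (hs : s • y ≠ y) : ∃ A : Set HilbertCube, A ⊆ fanM r ρ ∧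
      ∃ φ : unitInterval ≃ₜ A, (φ 0 : HilbertCube) = s • y ∧ (φ 1 : HilbertCube) = y := by
  have hy0 : y ≠ 0 := by
    rintro rfl
    exact hs (by funext n; exact mul_zero _)
  have hs1 : (s : ℝ) ≠ 1 := fun h => hs (by
    rw [show s = 1 from Subtype.ext h, one_smul])
  have hmem : ∀ t : unitInterval, (s : ℝ) + (1 - s) * t ∈ Icc (0 : ℝ) 1 := fun t => by
    have h1 := s.2.1
    have h2 := s.2.2
    have h3 := t.2.1
    have h4 := t.2.2
    constructor <;> nlinarith
  obtain ⟨φ, hφ⟩ := exists_homeomorph_range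
    (f := fun t : unitInterval => clamp (s + (1 - s) * t) • y)
    ((continuous_smul_cube y).comp (continuous_clamp.comp (by fun_prop))) (fun t u htu => by
      have h := congrArg Subtype.val (smul_left_cancel_of_ne_zero hy0 htu)
      rw [coe_clamp (hmem t), coe_clamp (hmem u)] at h
      exact Subtype.ext (mul_left_cancel₀ (sub_ne_zero.2 hs1.symm) (add_left_cancel h)))
  refine ⟨_, ?_, φ, ?_, ?_⟩
  · rintro _ ⟨t, rfl⟩
    exact smul_mem_fanM hy _
  · rw [hφ]; simp [clamp_coe]
  · rw [hφ]; simp [clamp_one]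

theorem isArcwiseConnected_fanM {r ρ : ℝ} (hr : 0 < r) (hρ : 0 < ρ) :
    IsArcwiseConnected (fanM r ρ) := by
  intro x hx y hy hxy
  by_cases h : ∃ a, x ∈ lineSeq a ∧ y ∈ lineSeq a
  · obtain ⟨a, hxa, hya⟩ := h
    rcases le_total (x 0) (y 0) with h | h
    · obtain ⟨s, rfl⟩ := exists_eq_smul_of_le hxa hya h
      exact exists_arc_smul hy s hxy
    · obtain ⟨s, rfl⟩ := exists_eq_smul_of_le hya hxa h
      obtain ⟨A, hA, φ, h0, h1⟩ := exists_arc_smul hx s hxy.symm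
      exact ⟨A, hA, unitInterval.symmHomeomorph.trans φ, by simpa using h1, by simpa using h0⟩
  -- The origin lies on every `lineSeq`, so here both points are nonzero.
  · push Not at h
    obtain ⟨a, ha, hxa⟩ := exists_mem_lineSeq hx
    obtain ⟨b, hb, hyb⟩ := exists_mem_lineSeq hy
    have hd : OnDifferentRays x y := by
      refine onDifferentRays_of_seq_ne hr hρ ha hxa hyb ?_ ?_ ?_
      · rintro rfl; exact h b (zero_mem_lineSeq b) hyb
      · rintro rfl; exact h a hxa (zero_mem_lineSeq a)
      · rintro rfl; exact h a hxa hyb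
    obtain ⟨A, hA, φ, hφ⟩ := hd.exists_arc hx hy
    refine ⟨A, hA, φ, ?_, ?_⟩ <;> rw [hφ]
    · simp [doubleRay_one]
    · rw [show (1 : ℝ) - 2 * (1 : unitInterval) = -1 by norm_num, doubleRay_neg_one]

theorem isDendroid_fanM {r ρ : ℝ} (hr : 0 < r) (hρ : 0 < ρ) (hrρ : r ≠ ρ) :
    IsDendroid (fanM r ρ) :=
  ⟨isContinuum_fanM r ρ, isArcwiseConnected_fanM hr hρ,
    isHereditarilyUnicoherent_fanM hr hρ hrρ⟩

/-! ### End-points of the fan. -/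

/-- The coordinatewise maxima are attained simultaneously: every point of `lineSeq a` is a multiple,
by a factor at most `1`, of the one with largest coordinate `0`. -/
theorem maxCoord_mem_lineSeq (a : ℕ → ℝ) :
    maxCoord a ∈ lineSeq a ∧ ∀ x ∈ lineSeq a, ∃ t : unitInterval, x = t • maxCoord a := by
  obtain ⟨z, hz, hz0⟩ := (isGreatest_maxCoord a 0).1
  have hle : ∀ x ∈ lineSeq a, ∃ t : unitInterval, x = t • z := fun x hx =>
    exists_eq_smul_of_le hx hz (((isGreatest_maxCoord a 0).2 ⟨x, hx, rfl⟩).trans_eq hz0.symm)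
  have : maxCoord a = z := by
    funext n
    refine (isGreatest_maxCoord a n).unique ⟨⟨z, hz, rfl⟩, ?_⟩
    rintro _ ⟨x, hx, rfl⟩
    obtain ⟨t, rfl⟩ := hle x hx
    exact mul_le_of_le_one_left' t.2.2
  rw [this]
  exact ⟨hz, hle⟩

theorem exists_homeomorph_lineSeq {a : ℕ → ℝ} {x : HilbertCube} (hx : x ∈ lineSeq a)
    (hx0 : x ≠ 0) : ∃ φ : unitInterval ≃ₜ lineSeq a,
      ∀ t, (φ t : HilbertCube) = t • maxCoord a := by
  obtain ⟨hz, hle⟩ := maxCoord_mem_lineSeq a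
  have hz0 : maxCoord a ≠ 0 := by
    intro h
    obtain ⟨t, rfl⟩ := hle x hx
    exact hx0 (by rw [h]; funext n; exact mul_zero _)
  have hr : lineSeq a = range fun t : unitInterval => t • maxCoord a := by
    ext y
    constructor
    · intro hy
      obtain ⟨t, rfl⟩ := hle y hy
      exact ⟨t, rfl⟩
    · rintro ⟨t, rfl⟩
      exact smul_mem_lineSeq hz t
  rw [hr]
  exact exists_homeomorph_range (continuous_smul_cube _)
    fun s t h => smul_left_cancel_of_ne_zero hz0 h

theorem maxCoord_ne_zero_of_isArc {a : ℕ → ℝ} (h : IsArc (lineSeq a)) : maxCoord a ≠ 0 := by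
  intro h0
  obtain ⟨φ⟩ := h
  have hsub : ∀ t, (φ t : HilbertCube) = 0 := fun t => by
    obtain ⟨s, hs⟩ := (maxCoord_mem_lineSeq a).2 _ (φ t).2
    rw [hs, h0]; funext n; exact mul_zero _
  exact zero_ne_one (φ.injective (Subtype.ext ((hsub 0).trans (hsub 1).symm)))

/-- A path in `M_{r,ρ}` stays on a ray near a time at which it is not at the origin. -/
theorem exists_Icc_mem_lineSeq {r ρ : ℝ} (hr : 0 < r) (hρ : 0 < ρ) (hrρ : r ≠ ρ)
    {γ : ℝ → HilbertCube}
    (hγ : Continuous γ) (hmem : ∀ s, γ s ∈ fanM r ρ) {a : ℕ → ℝ} (ha : ∀ i, a i = r ∨ a i = ρ)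
    {t : ℝ} (hta : γ t ∈ lineSeq a) (ht0 : γ t ≠ 0) :
    ∃ ε > 0, ∀ s ∈ Icc (t - ε) (t + ε), γ s ∈ lineSeq a := by
  obtain ⟨ε, hε, hsub⟩ := Metric.nhds_basis_closedBall.mem_iff.1
    ((isOpen_ne_fun hγ continuous_const).mem_nhds ht0)
  rw [Real.closedBall_eq_Icc] at hsub
  refine ⟨ε, hε, fun s hs => ?_⟩
  refine subset_lineSeq_of_isPreconnected hr hρ hrρ (S := γ '' Icc (t - ε) (t + ε)) ?_
    (isPreconnected_Icc.image _ hγ.continuousOn) ?_ ha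
    ⟨t, ⟨by linarith, by linarith⟩, rfl⟩ hta ⟨s, hs, rfl⟩
  · rintro _ ⟨u, -, rfl⟩
    exact hmem u
  · rintro ⟨u, hu, h⟩
    exact hsub hu h

/-- If the tip were interior to an arc, the arc would stay in `lineSeq a` near it. There coordinate
`0` is injective, hence strictly monotone along the arc, and cannot have an interior maximum. -/
theorem maxCoord_mem_endPoints {r ρ : ℝ} (hr : 0 < r) (hρ : 0 < ρ) (hrρ : r ≠ ρ) {a : ℕ → ℝ}
    (ha : a ∈ usefulSeqs r ρ) : maxCoord a ∈ endPoints (fanM r ρ) := by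
  obtain ⟨ha, harc⟩ := ha
  refine ⟨lineSeq_subset_fanM ha (maxCoord_mem_lineSeq a).1, fun A hA ⟨φ⟩ hxA => ?_⟩
  obtain ⟨t, ht⟩ := φ.surjective ⟨_, hxA⟩
  have ht' : (φ t : HilbertCube) = maxCoord a := congrArg Subtype.val ht
  refine isArcEndPoint_of_eq_zero_or_one φ ht' ?_
  by_contra! hne
  have ht0 : 0 < (t : ℝ) := unitInterval.pos_iff_ne_zero.2 hne.1
  have ht1 : (t : ℝ) < 1 := unitInterval.lt_one_iff_ne_one.2 hne.2
  obtain ⟨ε, hε, hline⟩ := exists_Icc_mem_lineSeq hr hρ hrρ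
    (γ := fun s => (φ (clamp s) : HilbertCube))
    (continuous_subtype_val.comp (φ.continuous.comp continuous_clamp)) (fun s => hA (φ _).2) ha
    (t := t) (by simp only [clamp_coe, ht']; exact (maxCoord_mem_lineSeq a).1)
    (by simp only [clamp_coe, ht']; exact maxCoord_ne_zero_of_isArc harc)
  -- The bounds keep `[t - δ, t + δ]` inside `[0,1]`, where `clamp` is injective.
  obtain ⟨δ, hδ, hδε, hδt, hδt1⟩ : ∃ δ > 0, δ ≤ ε ∧ δ ≤ t ∧ δ ≤ 1 - t :=
    ⟨min ε (min t (1 - t)), by simp [*], by simp, by simp, by simp⟩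
  have hline' : ∀ s ∈ Icc ((t : ℝ) - δ) (t + δ), (φ (clamp s) : HilbertCube) ∈ lineSeq a :=
    fun s hs => hline s ⟨by linarith [hs.1], by linarith [hs.2]⟩
  have hle : ∀ s ∈ Icc ((t : ℝ) - δ) (t + δ),
      (φ (clamp s) : HilbertCube) 0 ≤ (φ (clamp t) : HilbertCube) 0 := fun s hs => by
    rw [clamp_coe, ht']
    exact (isGreatest_maxCoord a 0).2 ⟨_, hline' s hs, rfl⟩
  have hcont : Continuous fun s : ℝ => (φ (clamp s) : HilbertCube) 0 :=
    (continuous_apply 0).comp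
      (continuous_subtype_val.comp (φ.continuous.comp continuous_clamp))
  rcases hcont.continuousOn.strictMonoOn_of_injOn_Icc' (a := (t : ℝ) - δ) (b := t + δ)
    (by linarith) (fun s hs u hu hsu => by
      have h := φ.injective (Subtype.ext (eq_of_mem_lineSeq (hline' s hs) (hline' u hu) hsu))
      rw [← coe_clamp (u := s) ⟨by linarith [hs.1], by linarith [hs.2]⟩, h,
        coe_clamp ⟨by linarith [hu.1], by linarith [hu.2]⟩]) with hm | hm
  · exact (hm ⟨by linarith, by linarith⟩ ⟨by linarith, le_rfl⟩
      (show (t : ℝ) < t + δ by linarith)).not_ge (hle _ ⟨by linarith, le_rfl⟩)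
  · exact (hm ⟨le_rfl, by linarith⟩ ⟨by linarith, by linarith⟩
      (show (t : ℝ) - δ < t by linarith)).not_ge (hle _ ⟨le_rfl, by linarith⟩)

/-- `M_{r,ρ}` contains three pairwise different rays. -/
theorem exists_three_rays {r ρ : ℝ} (hr : 0 < r) (hr1 : r < 1) (hρ : 1 < ρ) :
    ∃ x ∈ fanM r ρ, ∃ y ∈ fanM r ρ, ∃ w ∈ fanM r ρ,
      OnDifferentRays x y ∧ OnDifferentRays x w ∧ OnDifferentRays y w := by
  have hρ0 : 0 < ρ := one_pos.trans hρ
  have hrρ : r ≠ ρ := (hr1.trans hρ).ne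
  let R : unitInterval := ⟨r, hr.le, hr1.le⟩
  let P : unitInterval := ⟨ρ⁻¹, (inv_pos.2 hρ0).le, (inv_lt_one_of_one_lt₀ hρ).le⟩
  -- All slopes are `r`, except for a single `ρ` at index `0` for `y` and at index `1` for `w`.
  -- Starting at `ρ⁻¹` keeps these points in the cube.
  let x : HilbertCube := fun n => R ^ n
  let y : HilbertCube := fun n => match n with
    | 0 => P
    | n + 1 => R ^ n
  let w : HilbertCube := fun n => match n with
    | 0 => P
    | 1 => R * P
    | n + 2 => R ^ (n + 1)
  let a : ℕ → ℝ := fun _ => r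
  let b : ℕ → ℝ := fun n => if n = 0 then ρ else r
  let c : ℕ → ℝ := fun n => if n = 1 then ρ else r
  have ha : ∀ i, a i = r ∨ a i = ρ := fun _ => .inl rfl
  have hb : ∀ i, b i = r ∨ b i = ρ := fun i => by
    by_cases h : i = 0 <;> simp [b, h]
  have hc : ∀ i, c i = r ∨ c i = ρ := fun i => by
    by_cases h : i = 1 <;> simp [c, h]
  have hx : x ∈ lineSeq a := fun i => by
    show r ^ (i + 1) = r * r ^ i
    ring
  have hy : y ∈ lineSeq b := fun i => by
    match i with
    | 0 =>
      show r ^ 0 = (if (0 : ℕ) = 0 then ρ else r) * ρ⁻¹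
      simp [hρ0.ne']
    | i + 1 =>
      show r ^ (i + 1) = (if i + 1 = 0 then ρ else r) * r ^ i
      simp [pow_succ']
  have hw : w ∈ lineSeq c := fun i => by
    match i with
    | 0 =>
      show r * ρ⁻¹ = (if (0 : ℕ) = 1 then ρ else r) * ρ⁻¹
      simp
    | 1 =>
      show r ^ 1 = (if (1 : ℕ) = 1 then ρ else r) * (r * ρ⁻¹)
      field_simp
      simp
    | i + 2 =>
      show r ^ (i + 2) = (if i + 2 = 1 then ρ else r) * r ^ (i + 1)
      simp [pow_succ']
  have hP : P ≠ 0 := fun h => (inv_pos.2 hρ0).ne' (congrArg Subtype.val h)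
  have hx0 : x ≠ 0 := fun h => one_ne_zero (α := unitInterval) (congrFun h 0)
  have hy0 : y ≠ 0 := fun h => hP (congrFun h 0)
  have hw0 : w ≠ 0 := fun h => hP (congrFun h 0)
  refine ⟨x, lineSeq_subset_fanM ha hx, y, lineSeq_subset_fanM hb hy, w,
    lineSeq_subset_fanM hc hw, ?_, ?_, ?_⟩
  · exact onDifferentRays_of_seq_ne hr hρ0 ha hx hy hx0 hy0
      fun h => hrρ (by simpa [a, b] using congrFun h 0)
  · exact onDifferentRays_of_seq_ne hr hρ0 ha hx hw hx0 hw0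
      fun h => hrρ (by simpa [a, c] using congrFun h 1)
  · exact onDifferentRays_of_seq_ne hr hρ0 hb hy hw hy0 hw0
      fun h => hrρ (by simpa [b, c] using congrFun h 1)

theorem endPoints_fanM {r ρ : ℝ} (hr : 0 < r) (hr1 : r < 1) (hρ : 1 < ρ) :
    endPoints (fanM r ρ) = {p | ∃ a ∈ usefulSeqs r ρ, p = maxCoord a} := by
  have hρ0 : 0 < ρ := one_pos.trans hρ
  refine Subset.antisymm ?_ ?_
  · rintro x ⟨hx, hend⟩
    have hx0 : x ≠ 0 := by
      rintro rfl
      -- The origin is interior to an arc made of two different rays.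
      obtain ⟨y, hy, z, hz, -, -, hd, -⟩ := exists_three_rays hr hr1 hρ
      obtain ⟨A, hA, φ, hφ⟩ := hd.exists_arc hy hz
      let t : unitInterval := ⟨1 / 2, by norm_num, by norm_num⟩
      have ht : (φ t : HilbertCube) = 0 := by
        rw [hφ, show (1 : ℝ) - 2 * (t : ℝ) = 0 by norm_num [t], doubleRay_zero]
      have h0 : (0 : HilbertCube) ∈ A := ht ▸ (φ t).2
      rcases (hend A hA ⟨φ⟩ h0).eq_zero_or_one φ ht with h | h
      · have := congrArg Subtype.val h
        norm_num [t] at this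
      · have := congrArg Subtype.val h
        norm_num [t] at this
    obtain ⟨a, ha, hxa⟩ := exists_mem_lineSeq hx
    obtain ⟨φ, hφ⟩ := exists_homeomorph_lineSeq hxa hx0
    obtain ⟨t, rfl⟩ := (maxCoord_mem_lineSeq a).2 x hxa
    refine ⟨a, ⟨ha, ⟨φ⟩⟩, ?_⟩
    rcases (hend _ (lineSeq_subset_fanM ha) ⟨φ⟩ hxa).eq_zero_or_one φ (hφ t) with rfl | rfl
    · exact absurd (zero_smul_cube _) hx0
    · exact one_smul _ _
  · rintro _ ⟨a, ha, rfl⟩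
    exact maxCoord_mem_endPoints hr hρ0 (hr1.trans hρ).ne ha

/-! ### The ramification point. -/

theorem mem_modelTriod {p : ℝ × ℝ} : p ∈ modelTriod ↔
    (p.1 ∈ Icc (-1 : ℝ) 1 ∧ p.2 = 0) ∨ (p.1 = 0 ∧ p.2 ∈ Icc (0 : ℝ) 1) := Iff.rfl

theorem isCompact_modelTriod : IsCompact modelTriod :=
  (isCompact_Icc.prod isCompact_singleton).union (isCompact_singleton.prod isCompact_Icc)

/-- A parametrization by the model triod of the union of the segments from the origin to
`x`, `y` and `w`. -/
noncomputable def tripleRay (x y w : HilbertCube) (p : ℝ × ℝ) : HilbertCube :=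
  fun n => doubleRay x y p.1 n ⊔ clamp p.2 * w n

theorem continuous_tripleRay (x y w : HilbertCube) : Continuous (tripleRay x y w) := by
  have := continuous_clamp
  have := continuous_doubleRay x y
  unfold tripleRay
  fun_prop

theorem tripleRay_of_snd_eq_zero (x y w : HilbertCube) {p : ℝ × ℝ} (hp : p.2 = 0) :
    tripleRay x y w p = doubleRay x y p.1 := by
  funext n
  simp only [tripleRay, hp, clamp_of_nonpos le_rfl, zero_mul]
  exact sup_eq_left.2 unitInterval.nonneg'

theorem tripleRay_of_fst_eq_zero (x y w : HilbertCube) {p : ℝ × ℝ} (hp : p.1 = 0) :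
    tripleRay x y w p = clamp p.2 • w := by
  funext n
  simp only [tripleRay, hp, doubleRay_zero]
  exact sup_eq_right.2 unitInterval.nonneg'

theorem injOn_tripleRay {x y w : HilbertCube} (hxy : OnDifferentRays x y)
    (hxw : OnDifferentRays x w) (hyw : OnDifferentRays y w) :
    InjOn (tripleRay x y w) modelTriod := by
  have aux : ∀ p q : ℝ × ℝ, p.1 ∈ Icc (-1 : ℝ) 1 → p.2 = 0 → q.1 = 0 → q.2 ∈ Icc (0 : ℝ) 1 →
      tripleRay x y w p = tripleRay x y w q → p = q := by
    intro p q hp1 hp2 hq1 hq2 h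
    have hq0 : q.2 = 0 := by
      rw [tripleRay_of_snd_eq_zero x y w hp2, tripleRay_of_fst_eq_zero x y w hq1] at h
      rw [← coe_clamp hq2]
      rcases le_total 0 p.1 with hp | hp
      · rw [doubleRay_of_nonneg x y hp] at h
        exact congrArg Subtype.val (hxw.eq_zero h).2
      · rw [doubleRay_of_nonpos x y hp] at h
        exact congrArg Subtype.val (hyw.eq_zero h).2
    rw [tripleRay_of_snd_eq_zero x y w hp2, tripleRay_of_snd_eq_zero x y w hq0] at h
    exact Prod.ext (hxy.injOn_doubleRay hp1 (by rw [hq1]; norm_num) h) (hp2.trans hq0.symm)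
  intro p hp q hq h
  rcases mem_modelTriod.1 hp with ⟨hp1, hp2⟩ | ⟨hp1, hp2⟩ <;>
    rcases mem_modelTriod.1 hq with ⟨hq1, hq2⟩ | ⟨hq1, hq2⟩
  · rw [tripleRay_of_snd_eq_zero x y w hp2, tripleRay_of_snd_eq_zero x y w hq2] at h
    exact Prod.ext (hxy.injOn_doubleRay hp1 hq1 h) (hp2.trans hq2.symm)
  · exact aux p q hp1 hp2 hq1 hq2 h
  · exact (aux q p hq1 hq2 hp1 hp2 h.symm).symm
  · rw [tripleRay_of_fst_eq_zero x y w hp1, tripleRay_of_fst_eq_zero x y w hq1] at h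
    refine Prod.ext (hp1.trans hq1.symm) ?_
    rw [← coe_clamp hp2, ← coe_clamp hq2, smul_left_cancel_of_ne_zero hxw.2.1 h]

theorem zero_mem_ramificationPoints {r ρ : ℝ} (hr : 0 < r) (hr1 : r < 1) (hρ : 1 < ρ) :
    (0 : HilbertCube) ∈ ramificationPoints (fanM r ρ) := by
  obtain ⟨x, hx, y, hy, w, hw, hxy, hxw, hyw⟩ := exists_three_rays hr hr1 hρ
  have := isCompact_iff_compactSpace.1 isCompact_modelTriod
  obtain ⟨φ, hφ⟩ := exists_homeomorph_range (f := fun p : modelTriod => tripleRay x y w p)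
    ((continuous_tripleRay x y w).comp continuous_subtype_val)
    (injOn_tripleRay hxy hxw hyw).injective
  refine ⟨_, ?_, φ, ?_⟩
  · rintro _ ⟨p, rfl⟩
    show tripleRay x y w p ∈ _
    rcases mem_modelTriod.1 p.2 with ⟨-, h⟩ | ⟨h, -⟩
    · rw [tripleRay_of_snd_eq_zero x y w h]
      exact doubleRay_mem_fanM hx hy _
    · rw [tripleRay_of_fst_eq_zero x y w h]
      exact smul_mem_fanM hw _
  · rw [hφ]
    exact (tripleRay_of_snd_eq_zero x y w rfl).trans (doubleRay_zero x y)

/-- The smaller of `f ε` and `g ε` is a value of the other function too. The codomain is a general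
linear order so that the order dual covers downward paths. -/
theorem exists_eq_of_lt_of_lt {Y : Type*} [LinearOrder Y] [TopologicalSpace Y]
    [OrderClosedTopology Y] {f g : ℝ → Y} (hf : Continuous f) (hg : Continuous g) {ε : ℝ}
    (hε : 0 < ε) (h0 : f 0 = g 0) (hfε : f 0 < f ε) (hgε : g 0 < g ε) :
    ∃ s ∈ Ioc 0 ε, ∃ t ∈ Ioc 0 ε, f s = g t := by
  have aux : ∀ {f g : ℝ → Y}, Continuous g → f 0 = g 0 → f 0 < f ε → f ε ≤ g ε →
      ∃ t ∈ Ioc 0 ε, g t = f ε := by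
    intro f g hg h0 hfε hle
    obtain ⟨t, ht, hgt⟩ := intermediate_value_Icc hε.le hg.continuousOn
      ⟨(h0 ▸ hfε).le, hle⟩
    refine ⟨t, ⟨ht.1.lt_of_ne ?_, ht.2⟩, hgt⟩
    rintro rfl
    exact hfε.ne (h0.trans hgt)
  rcases le_total (f ε) (g ε) with h | h
  · obtain ⟨t, ht, hgt⟩ := aux hg h0 hfε h
    exact ⟨ε, ⟨hε, le_rfl⟩, t, ht, hgt.symm⟩
  · obtain ⟨t, ht, hgt⟩ := aux hf h0.symm hgε h
    exact ⟨t, ht, ε, ⟨hε, le_rfl⟩, hgt⟩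

/-- The three arms of the model triod. -/
noncomputable def triodArm (i : Fin 3) (s : ℝ) : ℝ × ℝ :=
  ![((clamp s : ℝ), 0), (-(clamp s : ℝ), 0), (0, (clamp s : ℝ))] i

theorem triodArm_mem (i : Fin 3) (s : ℝ) : triodArm i s ∈ modelTriod := by
  have h0 := (clamp s).2.1
  have h1 := (clamp s).2.2
  rw [mem_modelTriod]
  fin_cases i
  · exact .inl ⟨⟨by show (-1 : ℝ) ≤ clamp s; linarith, h1⟩, rfl⟩
  · exact .inl ⟨⟨by show (-1 : ℝ) ≤ -clamp s; linarith, by show -(clamp s : ℝ) ≤ 1; linarith⟩,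
      rfl⟩
  · exact .inr ⟨rfl, h0, h1⟩

theorem continuous_triodArm (i : Fin 3) : Continuous (triodArm i) := by
  have := continuous_clamp
  fin_cases i
  · show Continuous fun s => ((clamp s : ℝ), (0 : ℝ))
    fun_prop
  · show Continuous fun s => (-(clamp s : ℝ), (0 : ℝ))
    fun_prop
  · show Continuous fun s => ((0 : ℝ), (clamp s : ℝ))
    fun_prop

theorem triodArm_zero (i : Fin 3) : triodArm i 0 = (0, 0) := by
  have h : (clamp 0 : ℝ) = 0 := congrArg Subtype.val (clamp_of_nonpos le_rfl)
  fin_cases i <;> simp [triodArm, h]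

theorem triodArm_inj {i j : Fin 3} {s t : ℝ} (hs : s ∈ Icc (0 : ℝ) 1) (ht : t ∈ Icc (0 : ℝ) 1)
    (h : triodArm i s = triodArm j t) : s = t ∧ (0 < s → i = j) := by
  have h1 := hs.1
  have h2 := ht.1
  fin_cases i <;> fin_cases j <;>
    simp [triodArm, coe_clamp hs, coe_clamp ht] at h ⊢ <;> grind

/-- Near a nonzero top all three arms lie on one ray, where coordinate `0` is injective. Two of them
leave in the same direction, so they meet again, contradicting injectivity of the triod's
parametrization. -/
theorem eq_zero_of_mem_ramificationPoints {r ρ : ℝ} (hr : 0 < r) (hρ : 0 < ρ) (hrρ : r ≠ ρ)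
    {x : HilbertCube} (hx : x ∈ ramificationPoints (fanM r ρ)) : x = 0 := by
  obtain ⟨T, hT, φ, hφ⟩ := hx
  by_contra hx0
  let γ : Fin 3 → ℝ → HilbertCube := fun i s => φ ⟨triodArm i s, triodArm_mem i s⟩
  have hγ : ∀ i, Continuous (γ i) := fun i =>
    continuous_subtype_val.comp (φ.continuous.comp ((continuous_triodArm i).subtype_mk _))
  have hγ0 : ∀ i, γ i 0 = x := fun i => by
    rw [← hφ]
    simp only [γ, triodArm_zero]
  have hinj : ∀ {i j s t}, γ i s = γ j t → triodArm i s = triodArm j t := fun h =>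
    congrArg Subtype.val (φ.injective (Subtype.ext h))
  have hmem : ∀ i s, γ i s ∈ fanM r ρ := fun i s => hT (φ _).2
  obtain ⟨a, ha, hxa⟩ := exists_mem_lineSeq (hγ0 0 ▸ hmem 0 0)
  have hε : ∀ i, ∃ ε > 0, ∀ s ∈ Icc (0 - ε) (0 + ε), γ i s ∈ lineSeq a := fun i =>
    exists_Icc_mem_lineSeq hr hρ hrρ (hγ i) (hmem i) ha (by rwa [hγ0]) (by rwa [hγ0])
  choose e he0 he using hε
  obtain ⟨ε, hε, hε1, hεe⟩ : ∃ ε > 0, ε ≤ 1 ∧ ∀ i, ε ≤ e i := by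
    refine ⟨min 1 (min (e 0) (min (e 1) (e 2))), by simp [he0], by simp, fun i => ?_⟩
    fin_cases i <;> simp
  have hline : ∀ i, ∀ s ∈ Icc 0 ε, γ i s ∈ lineSeq a := fun i s hs =>
    he i s ⟨by linarith [hs.1, he0 i], by linarith [hs.2, hεe i]⟩
  have key : ∀ {i j : Fin 3} {s t : ℝ}, s ∈ Icc 0 ε → t ∈ Icc 0 ε → γ i s 0 = γ j t 0 →
      s = t ∧ (0 < s → i = j) := fun {i j s t} hs ht h =>
    triodArm_inj ⟨hs.1, hs.2.trans hε1⟩ ⟨ht.1, ht.2.trans hε1⟩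
      (hinj (eq_of_mem_lineSeq (hline i s hs) (hline j t ht) h))
  have hcont : ∀ i, Continuous fun s => γ i s 0 := fun i => (continuous_apply 0).comp (hγ i)
  have hne : ∀ i, γ i 0 0 ≠ γ i ε 0 := fun i h =>
    hε.ne (key ⟨le_rfl, hε.le⟩ ⟨hε.le, le_rfl⟩ h).1
  have h00 : ∀ i j, γ i 0 0 = γ j 0 0 := fun i j => by rw [hγ0, hγ0]
  classical
  -- Pigeonhole: three arms, two directions along the ray.
  obtain ⟨i, j, hij, hdec⟩ := Fintype.exists_ne_map_eq_of_card_lt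
    (fun i : Fin 3 => decide (γ i 0 0 < γ i ε 0)) (by simp)
  have hiff : γ i 0 0 < γ i ε 0 ↔ γ j 0 0 < γ j ε 0 := by simpa using hdec
  obtain ⟨s, hs, t, ht, hst⟩ : ∃ s ∈ Ioc 0 ε, ∃ t ∈ Ioc 0 ε, γ i s 0 = γ j t 0 := by
    by_cases h : γ i 0 0 < γ i ε 0
    · exact exists_eq_of_lt_of_lt (hcont i) (hcont j) hε (h00 i j) h (hiff.1 h)
    · exact exists_eq_of_lt_of_lt (Y := unitIntervalᵒᵈ) (hcont i) (hcont j) hε (h00 i j)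
        ((not_lt.1 h).lt_of_ne (hne i).symm)
        ((not_lt.1 fun h' => h (hiff.2 h')).lt_of_ne (hne j).symm)
  exact hij ((key ⟨hs.1.le, hs.2⟩ ⟨ht.1.le, ht.2⟩ hst).2 hs.1)

theorem ramificationPoints_fanM {r ρ : ℝ} (hr : 0 < r) (hr1 : r < 1) (hρ : 1 < ρ) :
    ramificationPoints (fanM r ρ) = {(0 : HilbertCube)} :=
  Subset.antisymm
    (fun _ hx => eq_zero_of_mem_ramificationPoints hr (one_pos.trans hρ) (hr1.trans hρ).ne hx)
    (singleton_subset_iff.2 (zero_mem_ramificationPoints hr hr1 hρ))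

end MahavierFan

theorem theorem4p7 (r ρ : ℝ) (hr : 0 < r) (hNC : NeverConnect r ρ) :
    IsFan (fanM r ρ) ∧
      endPoints (fanM r ρ) = {p : HilbertCube | ∃ a ∈ usefulSeqs r ρ, p = maxCoord a} ∧
      ramificationPoints (fanM r ρ) = {(fun _ => 0 : HilbertCube)} := by
  obtain ⟨hr1, hρ, -⟩ := hNC
  have hR := ramificationPoints_fanM hr hr1 hρ
  exact ⟨⟨isDendroid_fanM hr (one_pos.trans hρ) (hr1.trans hρ).ne,
    hR ▸ Set.subsingleton_singleton⟩, endPoints_fanM hr hr1 hρ, hR⟩
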